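/- Let $f(X)\in\mathbb{Z}[X]$ be a polynomial of degree $n\ge 1$ with splitting field $K$ over $\mathbb{Q}$ and leading coefficient $c_f$. Let $S$ be a finite set of primes, let $S'\subseteq S$ be the subset of all $p\in S$ such that $f$ has a root in the ring $\mathbb{Z}_p$ of $p$-adic integers, and put $s':=\#S'$. For a non-zero integer $y$ let $[y]_S:=\prod_{p\in S}p^{v_p(y)}$ be the $S$-part of $y$, and for $\varepsilon,B>0$ let \[ N(f,S,\varepsilon,B):=\#\{x\in\mathbb{Z} : |x|\le B,\ 0<|f(x)|^{\varepsilon}\le [f(x)]_S\}. \] Let $R(f)$ denote the largest multiplicity of a root of $f$ in $K$. Suppose that $s'\ge 1$ and that every $p\in S'$ splits completely in $K$ and does not divide $c_f$. Then for every $\varepsilon\in(0,R(f)/n)$ one has \[ N(f,S,\varepsilon,B)\asymp_{f,S,\varepsilon} B^{1-n\varepsilon/R(f)}(\log B)^{s'-1}\qquad\text{as } B\to\infty, \] that is, there are constants $c,C>0$ and $B_0$, depending only on $f,S,\varepsilon$, such that for all real $B\ge B_0$ the left-hand side lies between $c$ and $C$ times $B^{1-n\varepsilon/R(f)}(\log B)^{s'-1}$.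 -/

import Mathlib

open Polynomial Asymptotics Filter NumberField

namespace SParts

/-- The `S`-part `[y]_S = ∏_{p ∈ S} p ^ v_p(y)` of a (non-zero) integer `y`. -/
def sPart (S : Finset ℕ) (y : ℤ) : ℕ :=
  ∏ p ∈ S, p ^ padicValInt p y

/-- `p` is a prime and `f` has a root in the ring `ℤ_p` of `p`-adic integers. -/
def HasPadicRoot (f : ℤ[X]) (p : ℕ) : Prop :=
  ∃ _ : Fact p.Prime, ∃ x : ℤ_[p], aeval x f = 0

open scoped Classical in
/-- The subset `S'` of all `p ∈ S` such that `f` has a root in `ℤ_p`. -/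
noncomputable def rootPrimes (f : ℤ[X]) (S : Finset ℕ) : Finset ℕ :=
  S.filter (HasPadicRoot f)

/-- The rational prime `p` splits completely in the number field `K`: every prime of `𝓞 K` above
`p` has ramification index and inertia degree equal to `1`. -/
def SplitsCompletely (p : ℕ) (K : Type*) [Field K] : Prop :=
  ∀ P ∈ Ideal.primesOver (Ideal.span {(p : ℤ)}) (𝓞 K),
    P.ramificationIdx ℤ = 1 ∧ P.inertiaDeg ℤ = 1

open scoped Classical in
/-- The largest multiplicity `R(f)` of a root of `f` in the field `K`. -/
noncomputable def maxRootMultiplicity (f : ℤ[X]) (K : Type*) [Field K] : ℕ :=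
  (f.aroots K).toFinset.sup fun α => (f.map (algebraMap ℤ K)).rootMultiplicity α

/-- `N(f, S, ε, B)`, the number of integers `x` such that `|x| ≤ B` and
`0 < |f(x)| ^ ε ≤ [f(x)]_S`. -/
noncomputable def countN (f : ℤ[X]) (S : Finset ℕ) (ε B : ℝ) : ℕ :=
  {x : ℤ | |(x : ℝ)| ≤ B ∧ 0 < |((f.eval x : ℤ) : ℝ)| ^ ε ∧
    |((f.eval x : ℤ) : ℝ)| ^ ε ≤ (sPart S (f.eval x) : ℝ)}.ncard

end SParts

/-! Complete splitting of `p` embeds `K` into `ℚ_[p]`, so the roots of `f` in `ℤ_[p]` come from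
roots in `K` and have multiplicity at most `R`. Since `p` does not divide the leading coefficient, a
root of multiplicity exactly `R` also lies in `ℤ_[p]`. Hence, up to a constant, the `p`-part of
`f(x)` is at most `p ^ (k R)`, where `x` agrees with some point of a fixed finite set modulo `p ^
k`; and it is at least `p ^ (k R)` when that point is a root of multiplicity `R`. Primes of `S`
outside `S'` contribute a bounded factor.

For `|x|` of size `B` one has `|f(x)| ≍ B ^ n`, apart from bounded `x` in the lower estimate. The
condition thus becomes `∏ p ^ k_p ≫ B ^ θ` with `θ = n ε / R`. Exponent vectors with product within
a constant factor of `B ^ θ` have `s' - 1` free coordinates of size `≪ log B`, the last being fixed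
up to boundedly many choices. By the Chinese remainder theorem each vector and choice of points
gives one residue class modulo `≍ B ^ θ`, with `≍ B ^ (1 - θ)` integers.

For the upper bound (`exists_eventually_countN_le`) exponents are lowered into this window and the
shells `B / 2 < |x| ≤ B` are summed. For the lower bound (`exists_eventually_le_countN`) exact
orders of approximation make the classes disjoint. -/

namespace SParts

/-! ### Complete splitting gives an embedding into the `p`-adic numbers. -/

section Embedding

variable {K : Type*} [Field K] [NumberField K] {p : ℕ}

/-- Since `(p) = P J` with `P ∤ J`, the `P`-adic order of `p ^ k` is exactly `k`. -/
theorem natCast_pow_notMem_pow_succ (hp : p.Prime) {P : Ideal (𝓞 K)} (hP : P.IsPrime)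
    (hP2 : (p : 𝓞 K) ∉ P ^ 2) (hpP : (p : 𝓞 K) ∈ P) (k : ℕ) :
    (p : 𝓞 K) ^ k ∉ P ^ (k + 1) := by
  intro hk
  have hP0 : P ≠ ⊥ := by
    rintro rfl
    exact hp.ne_zero (by simpa using hpP)
  obtain ⟨J, hJ⟩ : P ∣ Ideal.span {(p : 𝓞 K)} := by simpa [Ideal.dvd_span_singleton] using hpP
  have hPprime : Prime P := Ideal.prime_of_isPrime hP0 hP
  have hPJ : ¬ P ∣ J := by
    rintro ⟨J', rfl⟩
    apply hP2
    rw [← Ideal.dvd_span_singleton, hJ]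
    exact ⟨J', by ring⟩
  have h1 : P ^ (k + 1) ∣ P ^ k * J ^ k := by
    rw [← mul_pow, ← hJ, Ideal.span_singleton_pow, Ideal.dvd_span_singleton]
    exact hk
  rw [pow_succ, mul_dvd_mul_iff_left (pow_ne_zero _ hP0)] at h1
  exact hPJ (hPprime.dvd_of_dvd_pow h1)

/-- The quotient has `p ^ k` elements, and no smaller power of `p` vanishes in it, so its
characteristic equals its cardinality. -/
theorem exists_ringEquiv_zmod_quotient_pow (hp : p.Prime) {P : Ideal (𝓞 K)} (hP : P.IsPrime)
    (hP2 : (p : 𝓞 K) ∉ P ^ 2) (hpP : (p : 𝓞 K) ∈ P) (hN : Ideal.absNorm P = p) (k : ℕ) :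
    Nonempty (ZMod (p ^ k) ≃+* 𝓞 K ⧸ P ^ k) := by
  have hcard : Nat.card (𝓞 K ⧸ P ^ k) = p ^ k := by
    have h := Ideal.absNorm_apply (P ^ k)
    rw [map_pow, hN, Submodule.cardQuot_apply] at h
    exact h.symm
  have : NeZero (p ^ k) := ⟨pow_ne_zero _ hp.ne_zero⟩
  have : Finite (𝓞 K ⧸ P ^ k) :=
    Nat.finite_of_card_ne_zero (by rw [hcard]; exact pow_ne_zero _ hp.ne_zero)
  have : Fintype (𝓞 K ⧸ P ^ k) := Fintype.ofFinite _
  have hchar : CharP (𝓞 K ⧸ P ^ k) (p ^ k) := by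
    have h0 : ((p ^ k : ℕ) : 𝓞 K ⧸ P ^ k) = 0 := by
      rw [← hcard, Nat.card_eq_fintype_card]
      exact Nat.cast_card_eq_zero _
    obtain ⟨j, hjk, hj⟩ := (Nat.dvd_prime_pow hp).1
      ((CharP.cast_eq_zero_iff (𝓞 K ⧸ P ^ k) (ringChar _) (p ^ k)).1 h0)
    rcases hjk.eq_or_lt with rfl | hlt
    · rw [← hj]; infer_instance
    · exfalso
      have h1 : ((p ^ j : ℕ) : 𝓞 K ⧸ P ^ k) = 0 := by
        rw [← hj]; exact CharP.cast_eq_zero _ _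
      have h2 : (p : 𝓞 K) ^ j ∈ P ^ k := by
        rw [← Ideal.Quotient.eq_zero_iff_mem]
        simpa using h1
      exact natCast_pow_notMem_pow_succ hp hP hP2 hpP j (Ideal.pow_le_pow_right hlt h2)
  exact ⟨ZMod.ringEquiv _ (by rw [← Nat.card_eq_fintype_card, hcard])⟩

theorem exists_ringHom_padicInt [Fact p.Prime] {P : Ideal (𝓞 K)} (hP : P.IsPrime)
    (hP2 : (p : 𝓞 K) ∉ P ^ 2) (hpP : (p : 𝓞 K) ∈ P) (hN : Ideal.absNorm P = p) :
    Nonempty (𝓞 K →+* ℤ_[p]) := by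
  have hp : p.Prime := Fact.out
  have e := fun k => (exists_ringEquiv_zmod_quotient_pow hp hP hP2 hpP hN k).some
  let g : ∀ k, 𝓞 K →+* ZMod (p ^ k) := fun k =>
    ((e k).symm : (𝓞 K ⧸ P ^ k) →+* ZMod (p ^ k)).comp (Ideal.Quotient.mk (P ^ k))
  suffices hg : ∀ (k1 k2 : ℕ) (hk : k1 ≤ k2),
      (ZMod.castHom (pow_dvd_pow p hk) (ZMod (p ^ k1))).comp (g k2) = g k1 from
    ⟨PadicInt.lift hg⟩
  -- Compatibility is automatic: a ring has at most one homomorphism from `ZMod`.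
  intro k1 k2 hk
  have hc : ((e k1 : ZMod (p ^ k1) →+* _)).comp (ZMod.castHom (pow_dvd_pow p hk) (ZMod (p ^ k1)))
      = (Ideal.Quotient.factor (Ideal.pow_le_pow_right hk : P ^ k2 ≤ P ^ k1)).comp
        (e k2 : ZMod (p ^ k2) →+* _) :=
    Subsingleton.elim _ _
  ext1 x
  apply (e k1).injective
  have := RingHom.congr_fun hc ((e k2).symm (Ideal.Quotient.mk _ x))
  simp only [g, RingHom.comp_apply, RingHom.coe_coe, RingEquiv.apply_symm_apply,
    Ideal.Quotient.factor_mk] at this ⊢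
  exact this

theorem exists_ringHom_padic_of_splitsCompletely [hp : Fact p.Prime] (h : SplitsCompletely p K) :
    Nonempty (K →+* ℚ_[p]) := by
  have hpZ : Prime (p : ℤ) := Nat.prime_iff_prime_int.1 hp.out
  have hspan : (Ideal.span {(p : ℤ)}).IsPrime := by
    rwa [Ideal.span_singleton_prime hpZ.ne_zero]
  have hne : Ideal.span {(p : ℤ)} ≠ ⊥ := by simpa using hpZ.ne_zero
  have hmax : (Ideal.span {(p : ℤ)}).IsMaximal := hspan.isMaximal hne
  obtain ⟨P, hPm⟩ : Nonempty (Ideal.primesOver (Ideal.span {(p : ℤ)}) (𝓞 K)) := inferInstance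
  obtain ⟨he, hf⟩ := h P hPm
  have hP : P.IsPrime := hPm.1
  have hPo : P.LiesOver (Ideal.span {(p : ℤ)}) := hPm.2
  have hPmax : P.IsMaximal := Ideal.IsMaximal.of_liesOver_isMaximal P (Ideal.span {(p : ℤ)})
  rw [← Ideal.ramificationIdx'_eq_ramificationIdx (Ideal.span {(p : ℤ)}) P hne] at he
  rw [← Ideal.inertiaDeg'_eq_inertiaDeg (Ideal.span {(p : ℤ)}) P] at hf
  have hmap : Ideal.map (algebraMap ℤ (𝓞 K)) (Ideal.span {(p : ℤ)}) = Ideal.span {(p : 𝓞 K)} := by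
    simp [Ideal.map_span]
  have hle : Ideal.map (algebraMap ℤ (𝓞 K)) (Ideal.span {(p : ℤ)}) ≤ P :=
    Ideal.map_le_iff_le_comap.2 (Ideal.over_def P (Ideal.span {(p : ℤ)})).le
  have hpP : (p : 𝓞 K) ∈ P := by
    rwa [hmap, Ideal.span_singleton_le_iff_mem] at hle
  have hP2 : (p : 𝓞 K) ∉ P ^ 2 := by
    intro h2
    refine (Ideal.ramificationIdx'_ne_one_iff hle).2 ?_ he
    rwa [hmap, Ideal.span_singleton_le_iff_mem]
  have hN : Ideal.absNorm P = p := by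
    rw [Ideal.absNorm_eq_pow_inertiaDeg' P hp.out, hf, pow_one]
  obtain ⟨φ⟩ := exists_ringHom_padicInt hP hP2 hpP hN
  -- The kernel meets `ℤ` trivially, and in an integral extension that is a domain only the zero
  -- ideal does so.
  have hφ : Function.Injective φ := by
    rw [RingHom.injective_iff_ker_eq_bot]
    apply Ideal.eq_bot_of_comap_eq_bot (R := ℤ)
    rw [RingHom.comap_ker, ← RingHom.injective_iff_ker_eq_bot]
    exact (φ.comp (algebraMap ℤ (𝓞 K))).injective_int
  have hinj : Function.Injective ((algebraMap ℤ_[p] ℚ_[p]).comp φ) :=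
    (IsFractionRing.injective ℤ_[p] ℚ_[p]).comp hφ
  exact ⟨IsFractionRing.lift hinj⟩

end Embedding

/-! ### The `p`-part of a polynomial value and approximation of roots. -/

section Local

variable {p : ℕ} [Fact p.Prime]

/-- The cofactor of `(X - y) ^ m` is nonzero at `y`, so its norm stays above half its value nearby.
Raising `m` to `r` is harmless because norms are at most `1`. -/
theorem eventually_mul_norm_pow_le_norm_eval {g : ℤ_[p][X]} (hg : g ≠ 0) {r : ℕ} (y : ℤ_[p])
    (hy : g.rootMultiplicity y ≤ r) :
    ∃ δ : ℝ, 0 < δ ∧ ∀ᶠ x in nhds y, δ * ‖x - y‖ ^ r ≤ ‖g.eval x‖ := by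
  obtain ⟨h, hh, hdvd⟩ := exists_eq_pow_rootMultiplicity_mul_and_not_dvd g hg y
  rw [dvd_iff_isRoot, IsRoot.def] at hdvd
  have hpos : 0 < ‖h.eval y‖ := norm_pos_iff.2 hdvd
  refine ⟨‖h.eval y‖ / 2, by positivity, ?_⟩
  have hcont : Tendsto (fun x => ‖h.eval x‖) (nhds y) (nhds ‖h.eval y‖) :=
    h.continuous.norm.continuousAt
  filter_upwards [hcont.eventually (lt_mem_nhds (half_lt_self hpos))] with x hx
  rw [hh, eval_mul, eval_pow, eval_sub, eval_X, eval_C, norm_mul, norm_pow, mul_comm]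
  gcongr ?_ * ?_
  exact pow_le_pow_of_le_one (norm_nonneg _) (PadicInt.norm_le_one _) hy

/-- Compactness of `ℤ_[p]` makes the local bounds uniform; the points of `A` need not be roots. -/
theorem exists_finset_mul_norm_pow_le_norm_eval {g : ℤ_[p][X]} (hg : g ≠ 0) {r : ℕ}
    (hr : ∀ y, g.rootMultiplicity y ≤ r) :
    ∃ (A : Finset ℤ_[p]) (δ : ℝ), 0 < δ ∧ ∀ x, ∃ y ∈ A, δ * ‖x - y‖ ^ r ≤ ‖g.eval x‖ := by
  choose d hd hev using fun y => eventually_mul_norm_pow_le_norm_eval hg y (hr y)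
  obtain ⟨A, -, hA⟩ := isCompact_univ.elim_nhds_subcover
    (fun y => {x : ℤ_[p] | d y * ‖x - y‖ ^ r ≤ ‖g.eval x‖}) fun y _ => hev y
  have hAne : A.Nonempty := by
    by_contra hne
    rw [Finset.not_nonempty_iff_eq_empty] at hne
    simpa [hne] using hA (Set.mem_univ 0)
  refine ⟨A, A.inf' hAne d, (Finset.lt_inf'_iff hAne).2 fun y _ => hd y, fun x => ?_⟩
  obtain ⟨y, hyA, hxy⟩ := Set.mem_iUnion₂.1 (hA (Set.mem_univ x))
  refine ⟨y, hyA, le_trans ?_ hxy⟩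
  gcongr
  exact Finset.inf'_le _ hyA

theorem eval_map_castRingHom (f : ℤ[X]) (x : ℤ) :
    (f.map (Int.castRingHom ℤ_[p])).eval (x : ℤ_[p]) = ((f.eval x : ℤ) : ℤ_[p]) := by
  rw [← eq_intCast (Int.castRingHom ℤ_[p]) x, eval_map, eval₂_at_apply]
  simp

theorem map_castRingHom_ne_zero {f : ℤ[X]} (hf : f ≠ 0) :
    f.map (Int.castRingHom ℤ_[p]) ≠ 0 :=
  (Polynomial.map_ne_zero_iff (RingHom.injective_int _)).2 hf

theorem exists_pow_padicValInt_eval_le {f : ℤ[X]} (hf : f ≠ 0) {r : ℕ}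
    (hr : ∀ y : ℤ_[p], (f.map (Int.castRingHom ℤ_[p])).rootMultiplicity y ≤ r) :
    ∃ (A : Finset ℤ_[p]) (C : ℝ), 0 < C ∧ ∀ x : ℤ, f.eval x ≠ 0 →
      ∃ y ∈ A, ∃ k : ℕ, (p : ℤ_[p]) ^ k ∣ (x : ℤ_[p]) - y ∧
        (p : ℝ) ^ padicValInt p (f.eval x) ≤ C * ((p : ℝ) ^ k) ^ r := by
  obtain ⟨A, δ, hδ, h⟩ :=
    exists_finset_mul_norm_pow_le_norm_eval (map_castRingHom_ne_zero (p := p) hf) hr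
  have hp : 1 < (p : ℝ) := by exact_mod_cast (Fact.out : p.Prime).one_lt
  have hp0 : 0 < (p : ℝ) := by linarith
  -- The `1` serves the case `x = y`: there every `k` is admissible and `k = v` suffices.
  refine ⟨A, max δ⁻¹ 1, by positivity, fun x hx => ?_⟩
  obtain ⟨y, hy, hxy⟩ := h x
  rw [eval_map_castRingHom] at hxy
  set v := padicValInt p (f.eval x) with hv
  have hnorm : ‖((f.eval x : ℤ) : ℤ_[p])‖ ≤ (p : ℝ) ^ (-v : ℤ) := by
    rw [PadicInt.norm_int_le_pow_iff_dvd]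
    exact padicValInt_dvd _
  have key := hxy.trans hnorm
  rw [zpow_neg, zpow_natCast] at key
  have hvpos : 0 < (p : ℝ) ^ v := by positivity
  refine ⟨y, hy, ?_⟩
  have hfin : ∀ k : ℕ, δ * (((p : ℝ) ^ k)⁻¹) ^ r ≤ ((p : ℝ) ^ v)⁻¹ →
      (p : ℝ) ^ v ≤ max δ⁻¹ 1 * ((p : ℝ) ^ k) ^ r := by
    intro k hk
    refine le_trans ?_ (mul_le_mul_of_nonneg_right (le_max_left _ _) (by positivity))
    rw [inv_pow, ← div_eq_mul_inv, div_le_iff₀ (by positivity), inv_mul_eq_div,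
      le_div_iff₀ hvpos] at hk
    rw [inv_mul_eq_div, le_div_iff₀ hδ]
    linarith
  rcases eq_or_ne r 0 with rfl | hr0
  · exact ⟨0, by simp, hfin 0 (by simpa using key)⟩
  rcases eq_or_ne (x : ℤ_[p]) y with hxy0 | hne
  · refine ⟨v, by simp [hxy0], ?_⟩
    calc (p : ℝ) ^ v ≤ ((p : ℝ) ^ v) ^ r := le_self_pow₀ (one_le_pow₀ hp.le) hr0
      _ ≤ _ := le_mul_of_one_le_left (by positivity) (le_max_right _ _)
  · have hne' : (x : ℤ_[p]) - y ≠ 0 := sub_ne_zero.2 hne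
    have hnv := PadicInt.norm_eq_zpow_neg_valuation hne'
    refine ⟨((x : ℤ_[p]) - y).valuation, ?_, hfin _ ?_⟩
    · rw [← Ideal.mem_span_singleton, ← PadicInt.norm_le_pow_iff_mem_span_pow, hnv]
    · rwa [hnv, zpow_neg, zpow_natCast] at key

theorem mul_rootMultiplicity_le_padicValInt_eval {f : ℤ[X]} {y : ℤ_[p]} {x : ℤ}
    (hx : f.eval x ≠ 0) {k : ℕ} (hk : (p : ℤ_[p]) ^ k ∣ (x : ℤ_[p]) - y) :
    k * (f.map (Int.castRingHom ℤ_[p])).rootMultiplicity y ≤ padicValInt p (f.eval x) := by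
  set g := f.map (Int.castRingHom ℤ_[p])
  have h : (p : ℤ_[p]) ^ (k * g.rootMultiplicity y) ∣ ((f.eval x : ℤ) : ℤ_[p]) := by
    rw [← eval_map_castRingHom]
    obtain ⟨q, hq⟩ := pow_rootMultiplicity_dvd g y
    have : g.eval (x : ℤ_[p]) = ((x : ℤ_[p]) - y) ^ g.rootMultiplicity y * q.eval (x : ℤ_[p]) := by
      conv_lhs => rw [hq]
      simp
    rw [this, pow_mul]
    exact (pow_dvd_pow_of_dvd hk _).mul_right _
  rw [PadicInt.pow_p_dvd_int_iff] at h
  simpa [padicValInt_dvd_iff, hx] using h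

theorem map_algebraMap_comp {K : Type*} [Field K] (σ : K →+* ℚ_[p]) (f : ℤ[X]) :
    (f.map (Int.castRingHom ℤ_[p])).map (algebraMap ℤ_[p] ℚ_[p]) =
      (f.map (algebraMap ℤ K)).map σ := by
  rw [Polynomial.map_map, Polynomial.map_map]
  congr 1
  exact Subsingleton.elim _ _

end Local

/-! ### Transfer of root multiplicities between `K` and `ℤ_[p]`. -/

section Multiplicity

variable {f : ℤ[X]} {K : Type*} [Field K] [Algebra ℚ K]

theorem rootMultiplicity_le_maxRootMultiplicity (hf : f ≠ 0) (β : K) :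
    (f.map (algebraMap ℤ K)).rootMultiplicity β ≤ maxRootMultiplicity f K := by
  classical
  have : CharZero K := algebraRat.charZero K
  have hinj : Function.Injective (algebraMap ℤ K) := RingHom.injective_int _
  have hf0 : f.map (algebraMap ℤ K) ≠ 0 := (Polynomial.map_ne_zero_iff hinj).2 hf
  by_cases hβ : (f.map (algebraMap ℤ K)).IsRoot β
  · unfold maxRootMultiplicity
    convert Finset.le_sup (f := fun α => (f.map (algebraMap ℤ K)).rootMultiplicity α)
      (Multiset.mem_toFinset.2 ((mem_roots hf0).2 hβ))
  · exact (rootMultiplicity_eq_zero hβ).trans_le (Nat.zero_le _)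

theorem splits_map_of_isSplittingField [(f.map (Int.castRingHom ℚ)).IsSplittingField ℚ K] :
    (f.map (algebraMap ℤ K)).Splits := by
  have := IsSplittingField.splits K (f.map (Int.castRingHom ℚ))
  rwa [Polynomial.map_map, Subsingleton.elim ((algebraMap ℚ K).comp (Int.castRingHom ℚ))
    (algebraMap ℤ K)] at this

theorem exists_rootMultiplicity_eq_maxRootMultiplicity (hf : 1 ≤ f.natDegree)
    [(f.map (Int.castRingHom ℚ)).IsSplittingField ℚ K] :
    ∃ β : K, (f.map (algebraMap ℤ K)).IsRoot β ∧
      (f.map (algebraMap ℤ K)).rootMultiplicity β = maxRootMultiplicity f K := by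
  classical
  have : CharZero K := algebraRat.charZero K
  have hinj : Function.Injective (algebraMap ℤ K) := RingHom.injective_int _
  have hf0 : f.map (algebraMap ℤ K) ≠ 0 := by
    rw [Polynomial.map_ne_zero_iff hinj]
    rintro rfl
    simp at hf
  obtain ⟨β₀, hβ₀⟩ := (splits_map_of_isSplittingField (f := f) (K := K)).exists_eval_eq_zero (by
    rw [degree_map_eq_of_injective hinj]
    exact (natDegree_pos_iff_degree_pos.1 hf).ne')
  have hne : (f.aroots K).toFinset.Nonempty := ⟨β₀, Multiset.mem_toFinset.2 ((mem_roots hf0).2 hβ₀)⟩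
  obtain ⟨β, hβ, h⟩ := Finset.exists_mem_eq_sup _ hne
    fun α => (f.map (algebraMap ℤ K)).rootMultiplicity α
  refine ⟨β, (mem_roots hf0).1 (Multiset.mem_toFinset.1 hβ), ?_⟩
  unfold maxRootMultiplicity
  convert h.symm

theorem one_le_maxRootMultiplicity (hf : 1 ≤ f.natDegree)
    [(f.map (Int.castRingHom ℚ)).IsSplittingField ℚ K] : 1 ≤ maxRootMultiplicity f K := by
  obtain ⟨β, hβ, h⟩ := exists_rootMultiplicity_eq_maxRootMultiplicity (K := K) hf
  have : CharZero K := algebraRat.charZero K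
  have hf0 : f.map (algebraMap ℤ K) ≠ 0 := by
    rw [Polynomial.map_ne_zero_iff (RingHom.injective_int _)]
    rintro rfl
    simp at hf
  rw [← h]
  exact (rootMultiplicity_pos hf0).2 hβ

variable {p : ℕ} [Fact p.Prime]

theorem rootMultiplicity_padicInt_le [(f.map (Int.castRingHom ℚ)).IsSplittingField ℚ K]
    (σ : K →+* ℚ_[p]) (hf : f ≠ 0) (y : ℤ_[p]) :
    (f.map (Int.castRingHom ℤ_[p])).rootMultiplicity y ≤ maxRootMultiplicity f K := by
  have : CharZero K := algebraRat.charZero K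
  have hf0 : f.map (algebraMap ℤ K) ≠ 0 :=
    (Polynomial.map_ne_zero_iff (RingHom.injective_int _)).2 hf
  rw [eq_rootMultiplicity_map (IsFractionRing.injective ℤ_[p] ℚ_[p]), map_algebraMap_comp σ]
  by_cases hy : ((f.map (algebraMap ℤ K)).map σ).IsRoot (algebraMap ℤ_[p] ℚ_[p] y)
  · obtain ⟨β, hβ⟩ := splits_map_of_isSplittingField.mem_range_of_isRoot hf0 hy
    rw [← hβ, ← eq_rootMultiplicity_map σ.injective]
    exact rootMultiplicity_le_maxRootMultiplicity hf β
  · exact (rootMultiplicity_eq_zero hy).trans_le (Nat.zero_le _)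

theorem exists_padicInt_rootMultiplicity_eq [(f.map (Int.castRingHom ℚ)).IsSplittingField ℚ K]
    (σ : K →+* ℚ_[p]) (hf : 1 ≤ f.natDegree) (hlead : ¬ (p : ℤ) ∣ f.leadingCoeff) :
    ∃ y : ℤ_[p],
      (f.map (Int.castRingHom ℤ_[p])).rootMultiplicity y = maxRootMultiplicity f K := by
  obtain ⟨β, hβ, h⟩ := exists_rootMultiplicity_eq_maxRootMultiplicity (K := K) hf
  have hroot : ((f.map (Int.castRingHom ℤ_[p])).map (algebraMap ℤ_[p] ℚ_[p])).IsRoot (σ β) := by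
    rw [map_algebraMap_comp σ]
    exact hβ.map
  have hunit : IsUnit (f.leadingCoeff : ℤ_[p]) := by
    rw [PadicInt.isUnit_iff]
    refine le_antisymm (PadicInt.norm_le_one _) (not_lt.1 fun hlt => hlead ?_)
    exact (PadicInt.norm_int_lt_one_iff_dvd _).1 hlt
  -- The leading coefficient is a `p`-adic unit, so dividing by it yields a monic equation.
  have hint : IsIntegral ℤ_[p] (σ β) := by
    obtain ⟨u, hu⟩ := hunit
    set g := f.map (Int.castRingHom ℤ_[p])
    have hlc : g.leadingCoeff = u := by
      rw [hu, leadingCoeff_map_of_injective (RingHom.injective_int _)]; simp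
    refine ⟨C (↑u⁻¹ : ℤ_[p]) * g, ?_, ?_⟩
    · rw [Monic, leadingCoeff_mul, leadingCoeff_C, hlc, Units.inv_mul]
    · rw [eval₂_mul, ← eval_map (algebraMap ℤ_[p] ℚ_[p]) (p := g), hroot.eq_zero, mul_zero]
  obtain ⟨y, hy⟩ := IsIntegrallyClosed.isIntegral_iff.1 hint
  refine ⟨y, ?_⟩
  rw [eq_rootMultiplicity_map (IsFractionRing.injective ℤ_[p] ℚ_[p]), map_algebraMap_comp σ, hy,
    ← eq_rootMultiplicity_map σ.injective, h]

theorem rootMultiplicity_eq_zero_of_not_hasPadicRoot (h : ¬ HasPadicRoot f p) (y : ℤ_[p]) :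
    (f.map (Int.castRingHom ℤ_[p])).rootMultiplicity y = 0 := by
  refine rootMultiplicity_eq_zero fun hy => h ⟨inferInstance, y, ?_⟩
  rwa [IsRoot.def, eval_map] at hy

end Multiplicity

/-! ### Counting exponent vectors whose product lies in a window. -/

section Exponents

variable {ι : Type*} [Fintype ι] {p : ι → ℕ}

/-- Lowering one exponent divides the product by at most `P`, so the descent cannot jump over `[T, T
P)`. -/
theorem exists_le_prod_pow_lt {P : ℕ} (hP : ∀ i, p i ≤ P) (hP1 : 1 < P)
    {T : ℝ} (hT : 1 ≤ T) (k : ι → ℕ) (hk : T ≤ ∏ i, (p i : ℝ) ^ k i) :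
    ∃ l ≤ k, T ≤ ∏ i, (p i : ℝ) ^ l i ∧ ∏ i, (p i : ℝ) ^ l i < T * P := by
  classical
  induction hn : ∑ i, k i using Nat.strong_induction_on generalizing k with
  | _ n ih =>
    by_cases hlt : ∏ i, (p i : ℝ) ^ k i < T * P
    · exact ⟨k, le_rfl, hk, hlt⟩
    rw [not_lt] at hlt
    have hP1' : (1 : ℝ) < P := by exact_mod_cast hP1
    obtain ⟨i, hi⟩ : ∃ i, k i ≠ 0 := by
      by_contra! h
      simp only [h, pow_zero, Finset.prod_const_one] at hlt
      nlinarith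
    set k' := Function.update k i (k i - 1) with hk'
    have hle : k' ≤ k := by
      rw [hk', update_le_iff]
      exact ⟨Nat.sub_le _ _, fun _ _ => le_rfl⟩
    have hprod : ∏ j, (p j : ℝ) ^ k j = (∏ j, (p j : ℝ) ^ k' j) * p i := by
      rw [← Finset.mul_prod_erase _ _ (Finset.mem_univ i),
        ← Finset.mul_prod_erase _ (fun j => (p j : ℝ) ^ k' j) (Finset.mem_univ i)]
      have h1 : ∏ j ∈ Finset.univ.erase i, (p j : ℝ) ^ k' j =
          ∏ j ∈ Finset.univ.erase i, (p j : ℝ) ^ k j :=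
        Finset.prod_congr rfl fun j hj => by
          rw [hk', Function.update_of_ne (Finset.ne_of_mem_erase hj)]
      rw [h1, hk', Function.update_self]
      obtain ⟨m, hm⟩ := Nat.exists_eq_succ_of_ne_zero hi
      rw [hm, Nat.succ_sub_one, pow_succ]
      ring
    have hT' : T ≤ ∏ j, (p j : ℝ) ^ k' j := by
      rw [hprod] at hlt
      have h2 : (p i : ℝ) ≤ P := by exact_mod_cast hP i
      have h3 : 0 ≤ ∏ j, (p j : ℝ) ^ k' j := by positivity
      by_contra! hcon
      have : (∏ j, (p j : ℝ) ^ k' j) * p i < T * P :=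
        (mul_le_mul_of_nonneg_left h2 h3).trans_lt
          (mul_lt_mul_of_pos_right hcon (by linarith))
      linarith
    have hsum : ∑ j, k' j < n := by
      rw [← hn]
      refine Finset.sum_lt_sum (fun j _ => hle j) ⟨i, Finset.mem_univ _, ?_⟩
      rw [hk', Function.update_self]
      omega
    obtain ⟨l, hl, h⟩ := ih _ hsum k' hT' rfl
    exact ⟨l, hl.trans hle, h⟩

theorem prod_ite_eq_mul_pow [DecidableEq ι] (i₀ : ι) (a b : ℕ) :
    ∏ i, (if i = i₀ then a else b) = a * b ^ (Fintype.card ι - 1) := by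
  rw [← Finset.mul_prod_erase _ _ (Finset.mem_univ i₀), if_pos rfl,
    Finset.prod_congr rfl fun i hi => if_neg (Finset.ne_of_mem_erase hi), Finset.prod_const,
    Finset.card_erase_of_mem (Finset.mem_univ _), Finset.card_univ]

/-- Otherwise the exponents at `i₀` differ by at least `P`, and a factor of at least `2 ^ P > P`
does not fit in the window. Thus the other coordinates and `l i₀ % P` determine `l`. -/
theorem le_of_prod_pow_bounds {P : ℕ} (hp : ∀ i, 2 ≤ p i) {T : ℝ} {l l' : ι → ℕ}
    (i₀ : ι) (hl : ∏ i, (p i : ℝ) ^ l i < T * P) (hl' : T ≤ ∏ i, (p i : ℝ) ^ l' i)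
    (heq : ∀ i ≠ i₀, l i = l' i) (hmod : l i₀ % P = l' i₀ % P) : l i₀ ≤ l' i₀ := by
  classical
  by_contra! hlt
  obtain ⟨c, hc⟩ : P ∣ l i₀ - l' i₀ := (Nat.modEq_iff_dvd' hlt.le).1 hmod.symm
  have hge : P ≤ l i₀ - l' i₀ := Nat.le_of_dvd (by omega) ⟨c, hc⟩
  have hprod : ∏ j, (p j : ℝ) ^ l j = (∏ j, (p j : ℝ) ^ l' j) * (p i₀ : ℝ) ^ (l i₀ - l' i₀) := by
    rw [← Finset.mul_prod_erase _ _ (Finset.mem_univ i₀),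
      ← Finset.mul_prod_erase _ (fun j => (p j : ℝ) ^ l' j) (Finset.mem_univ i₀),
      Finset.prod_congr rfl fun j hj => by rw [heq j (Finset.ne_of_mem_erase hj)]]
    conv_lhs => rw [show l i₀ = l' i₀ + (l i₀ - l' i₀) by omega, pow_add]
    ring
  have hpow : (P : ℝ) ≤ (p i₀ : ℝ) ^ (l i₀ - l' i₀) := by
    have : P ≤ p i₀ ^ (l i₀ - l' i₀) :=
      calc P ≤ 2 ^ P := Nat.lt_two_pow_self.le
        _ ≤ p i₀ ^ P := Nat.pow_le_pow_left (hp _) _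
        _ ≤ _ := Nat.pow_le_pow_right (by linarith [hp i₀]) hge
    exact_mod_cast this
  rw [hprod] at hl
  have : T * P ≤ (∏ j, (p j : ℝ) ^ l' j) * (p i₀ : ℝ) ^ (l i₀ - l' i₀) := by gcongr
  linarith

theorem exists_finset_exponents [Nonempty ι] {P : ℕ} (hp : ∀ i, 2 ≤ p i) (hP1 : 1 < P)
    {T : ℝ} {H : ℕ} (hH : T * P ≤ 2 ^ H) :
    ∃ L : Finset (ι → ℕ), (∀ l ∈ L, T ≤ ∏ i, (p i : ℝ) ^ l i) ∧
      (∀ l : ι → ℕ, T ≤ ∏ i, (p i : ℝ) ^ l i → ∏ i, (p i : ℝ) ^ l i < T * P → l ∈ L) ∧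
      L.card ≤ P * H ^ (Fintype.card ι - 1) := by
  classical
  obtain ⟨i₀⟩ := ‹Nonempty ι›
  let L := (Fintype.piFinset fun _ : ι => Finset.range H).filter fun l =>
    T ≤ ∏ i, (p i : ℝ) ^ l i ∧ ∏ i, (p i : ℝ) ^ l i < T * P
  refine ⟨L, fun l hl => (Finset.mem_filter.1 hl).2.1, fun l h1 h2 => ?_, ?_⟩
  · refine Finset.mem_filter.2 ⟨Fintype.mem_piFinset.2 fun i => Finset.mem_range.2 ?_, h1, h2⟩
    have h3 : (2 : ℝ) ^ l i ≤ ∏ j, (p j : ℝ) ^ l j := by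
      have hpi : (2 : ℝ) ≤ p i := by exact_mod_cast hp i
      calc (2 : ℝ) ^ l i ≤ (p i : ℝ) ^ l i := by gcongr
        _ ≤ ∏ j, (p j : ℝ) ^ l j := by
          rw [← Finset.mul_prod_erase _ _ (Finset.mem_univ i)]
          refine le_mul_of_one_le_right (by positivity) ?_
          exact_mod_cast Finset.one_le_prod' fun j _ => Nat.one_le_pow _ _ (by linarith [hp j])
    exact (pow_lt_pow_iff_right₀ (one_lt_two : (1 : ℝ) < 2)).1 (h3.trans_lt (h2.trans_le hH))
  · rw [← prod_ite_eq_mul_pow i₀]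
    have hcard : ∏ i, (if i = i₀ then P else H) =
        (Fintype.piFinset fun i => Finset.range (if i = i₀ then P else H)).card := by
      simp [Fintype.card_piFinset]
    rw [hcard]
    refine Finset.card_le_card_of_injOn (fun l => Function.update l i₀ (l i₀ % P)) ?_ ?_
    · intro l hl
      have hl' := Fintype.mem_piFinset.1 (Finset.mem_filter.1 hl).1
      refine Finset.mem_coe.2 (Fintype.mem_piFinset.2 fun i => ?_)
      by_cases hi : i = i₀
      · subst hi
        simpa using Nat.mod_lt _ (by omega)
      · simpa [hi] using hl' i
    · intro l hl l' hl' h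
      obtain ⟨-, h1, h2⟩ := Finset.mem_filter.1 hl
      obtain ⟨-, h1', h2'⟩ := Finset.mem_filter.1 hl'
      have heq : ∀ i ≠ i₀, l i = l' i := fun i hi => by
        simpa [hi] using congrFun h i
      have hmod : l i₀ % P = l' i₀ % P := by simpa using congrFun h i₀
      funext i
      by_cases hi : i = i₀
      · subst hi
        exact le_antisymm (le_of_prod_pow_bounds hp _ h2 h1' heq hmod)
          (le_of_prod_pow_bounds hp _ h2' h1 (fun j hj => (heq j hj).symm) hmod.symm)
      · exact heq i hi

end Exponents

/-! ### Integers of bounded size in a residue class. -/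

section Residues

/-- The integers of absolute value at most `B`. -/
noncomputable def intBox (B : ℝ) : Finset ℤ := Finset.Ioc (-⌊B⌋ - 1) ⌊B⌋

theorem mem_intBox {B : ℝ} {x : ℤ} : x ∈ intBox B ↔ |(x : ℝ)| ≤ B := by
  rw [intBox, Finset.mem_Ioc, abs_le, ← Int.le_floor, ← neg_le (a := (x : ℝ)), ← Int.cast_neg,
    ← Int.le_floor]
  omega

theorem card_intBox_filter_modEq_bounds {B : ℝ} (hB : 0 ≤ B) {M : ℕ} (hM : 0 < M) (v : ℤ) :
    (((intBox B).filter fun x => x ≡ v [ZMOD M]).card : ℤ) * M ≤ 2 * ⌊B⌋ + 1 + M ∧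
      2 * ⌊B⌋ + 1 - M ≤ (((intBox B).filter fun x => x ≡ v [ZMOD M]).card : ℤ) * M := by
  have hM' : (0 : ℚ) < M := by exact_mod_cast hM
  have hfl : (0 : ℚ) ≤ ⌊B⌋ := by exact_mod_cast Int.floor_nonneg.2 hB
  have h := Int.Ioc_filter_modEq_card (-⌊B⌋ - 1) ⌊B⌋ (r := (M : ℤ)) (by exact_mod_cast hM) v
  change (((intBox B).filter fun x => x ≡ v [ZMOD M]).card : ℤ) = _ at h
  rw [h]
  push_cast
  set X : ℚ := ((⌊B⌋ : ℚ) - v) / M with hX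
  set Y : ℚ := (-(⌊B⌋ : ℚ) - 1 - v) / M with hY
  have hXY : (X - Y) * M = 2 * ⌊B⌋ + 1 := by rw [hX, hY]; field_simp; ring
  have hX1 := Int.floor_le X
  have hX2 := Int.lt_floor_add_one X
  have hY1 := Int.floor_le Y
  have hY2 := Int.lt_floor_add_one Y
  constructor
  · have : max ((⌊X⌋ : ℚ) - ⌊Y⌋) 0 * M ≤ 2 * ⌊B⌋ + 1 + M := by
      rw [← hXY, max_mul_of_nonneg _ _ hM'.le]
      exact max_le (by nlinarith) (by rw [hXY]; linarith)
    exact_mod_cast this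
  · have : 2 * ⌊B⌋ + 1 - M ≤ max ((⌊X⌋ : ℚ) - ⌊Y⌋) 0 * M := by
      rw [← hXY]
      have := mul_le_mul_of_nonneg_right (le_max_left ((⌊X⌋ : ℚ) - ⌊Y⌋) 0) hM'.le
      nlinarith
    exact_mod_cast this

theorem card_intBox_filter_modEq_le {B : ℝ} (hB : 0 ≤ B) {M : ℕ} (hM : 0 < M) (v : ℤ) :
    (((intBox B).filter fun x => x ≡ v [ZMOD M]).card : ℝ) ≤ 2 * B / M + 2 := by
  have hM' : (1 : ℝ) ≤ M := by exact_mod_cast hM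
  have h := (card_intBox_filter_modEq_bounds hB hM v).1
  have h' : (((intBox B).filter fun x => x ≡ v [ZMOD M]).card : ℝ) * M ≤ 2 * ⌊B⌋ + 1 + M := by
    exact_mod_cast h
  rw [div_add' _ _ _ (by positivity), le_div_iff₀ (by positivity)]
  linarith [Int.floor_le B]

theorem le_card_intBox_filter_modEq {B : ℝ} {M : ℕ} (hM : 0 < M) (hB : 2 * M ≤ B) (v : ℤ) :
    B / M ≤ (((intBox B).filter fun x => x ≡ v [ZMOD M]).card : ℝ) := by
  have hM' : (1 : ℝ) ≤ M := by exact_mod_cast hM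
  have h := (card_intBox_filter_modEq_bounds (by linarith) hM v).2
  have h' : (2 * ⌊B⌋ + 1 - M : ℝ) ≤ (((intBox B).filter fun x => x ≡ v [ZMOD M]).card : ℝ) * M := by
    exact_mod_cast h
  rw [div_le_iff₀ (by positivity)]
  linarith [Int.lt_floor_add_one B]

end Residues

/-! ### Simultaneous `p`-adic approximation by integers. -/

section Approximation

variable {ι : Type*} [Fintype ι] {p : ι → ℕ} [∀ i, Fact (p i).Prime]

theorem modEq_of_pow_dvd_sub (hp : Function.Injective p) (y : ∀ i, ℤ_[p i]) (k : ι → ℕ)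
    {x x' : ℤ} (hx : ∀ i, (p i : ℤ_[p i]) ^ k i ∣ (x : ℤ_[p i]) - y i)
    (hx' : ∀ i, (p i : ℤ_[p i]) ^ k i ∣ (x' : ℤ_[p i]) - y i) :
    x ≡ x' [ZMOD (∏ i, p i ^ k i : ℕ)] := by
  rw [Int.modEq_iff_dvd]
  push_cast
  refine Fintype.prod_dvd_of_isRelPrime ?_ fun i => ?_
  · intro i j hij
    refine (Int.isCoprime_iff_gcd_eq_one.2 ?_).isRelPrime
    have := Nat.coprime_pow_primes (k i) (k j) (Fact.out : (p i).Prime) (Fact.out : (p j).Prime)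
      (hp.ne hij)
    exact_mod_cast this
  · have h := dvd_sub (hx' i) (hx i)
    rw [sub_sub_sub_cancel_right, ← Int.cast_sub, PadicInt.pow_p_dvd_int_iff] at h
    exact h

theorem pow_dvd_sub_of_modEq (y : ∀ i, ℤ_[p i]) (k : ι → ℕ)
    {x x' : ℤ} (hx : ∀ i, (p i : ℤ_[p i]) ^ k i ∣ (x : ℤ_[p i]) - y i)
    (h : x' ≡ x [ZMOD (∏ i, p i ^ k i : ℕ)]) (i : ι) :
    (p i : ℤ_[p i]) ^ k i ∣ (x' : ℤ_[p i]) - y i := by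
  have h1 : (p i : ℤ) ^ k i ∣ x' - x := by
    refine dvd_trans ?_ h.symm.dvd
    push_cast
    exact Finset.dvd_prod_of_mem (fun i => (p i : ℤ) ^ k i) (Finset.mem_univ i)
  rw [← PadicInt.pow_p_dvd_int_iff, Int.cast_sub] at h1
  simpa using dvd_add h1 (hx i)

theorem exists_int_pow_dvd_sub (hp : Function.Injective p) (y : ∀ i, ℤ_[p i]) (k : ι → ℕ) :
    ∃ x : ℤ, ∀ i, (p i : ℤ_[p i]) ^ k i ∣ (x : ℤ_[p i]) - y i := by
  classical
  obtain ⟨x, hx⟩ := Nat.chineseRemainderOfFinset (fun i => (y i).appr (k i)) (fun i => p i ^ k i)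
    Finset.univ (fun i _ => pow_ne_zero _ (Fact.out : (p i).Prime).ne_zero) (by
      intro i _ j _ hij
      exact Nat.coprime_pow_primes _ _ Fact.out Fact.out (hp.ne hij))
  refine ⟨x, fun i => ?_⟩
  have h1 := (hx i (Finset.mem_univ i)).symm.dvd
  push_cast at h1
  rw [← PadicInt.pow_p_dvd_int_iff] at h1
  have h2 := Ideal.mem_span_singleton.1 (PadicInt.appr_spec (k i) (y i))
  have h3 := dvd_sub h1 h2
  push_cast at h3 ⊢
  convert h3 using 1
  ring

theorem card_intBox_filter_pow_dvd_le (hp : Function.Injective p) (y : ∀ i, ℤ_[p i])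
    (k : ι → ℕ) {B T : ℝ} (hB : 0 ≤ B) (hT : 0 < T) (hk : T ≤ ∏ i, (p i : ℝ) ^ k i)
    (s : Finset ℤ)
    (hs : ∀ x ∈ s, |(x : ℝ)| ≤ B ∧ ∀ i, (p i : ℤ_[p i]) ^ k i ∣ (x : ℤ_[p i]) - y i) :
    (s.card : ℝ) ≤ 2 * B / T + 2 := by
  rcases s.eq_empty_or_nonempty with rfl | ⟨x₀, hx₀⟩
  · simp only [Finset.card_empty, Nat.cast_zero]; positivity
  have hsub : s ⊆ (intBox B).filter fun x => x ≡ x₀ [ZMOD (∏ i, p i ^ k i : ℕ)] := fun x hx =>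
    Finset.mem_filter.2 ⟨mem_intBox.2 (hs x hx).1,
      modEq_of_pow_dvd_sub hp y k (hs x hx).2 (hs x₀ hx₀).2⟩
  have hM : 0 < ∏ i, p i ^ k i :=
    Finset.prod_pos fun i _ => pow_pos (Fact.out : (p i).Prime).pos _
  calc (s.card : ℝ) ≤ _ := by exact_mod_cast Finset.card_le_card hsub
    _ ≤ 2 * B / (∏ i, p i ^ k i : ℕ) + 2 := card_intBox_filter_modEq_le hB hM x₀
    _ ≤ 2 * B / T + 2 := by
      gcongr
      exact_mod_cast hk

/-- After lowering, each `x` lies in a class indexed by a choice of points and a vector in the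
window; a union bound over these pairs suffices. -/
theorem card_close_le [Nonempty ι] (hp : Function.Injective p) {P : ℕ} (hP : ∀ i, p i ≤ P)
    (A : ∀ i, Finset ℤ_[p i]) {B T : ℝ} (hB : 0 ≤ B) (hT : 1 ≤ T) {H : ℕ} (hH : T * P ≤ 2 ^ H)
    (s : Finset ℤ)
    (hs : ∀ x ∈ s, |(x : ℝ)| ≤ B ∧ ∃ y : ∀ i, ℤ_[p i], (∀ i, y i ∈ A i) ∧ ∃ k : ι → ℕ,
      (∀ i, (p i : ℤ_[p i]) ^ k i ∣ (x : ℤ_[p i]) - y i) ∧ T ≤ ∏ i, (p i : ℝ) ^ k i) :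
    (s.card : ℝ) ≤
      (∏ i, (A i).card : ℕ) * (P * H ^ (Fintype.card ι - 1) : ℕ) * (2 * B / T + 2) := by
  classical
  have hp2 : ∀ i, 2 ≤ p i := fun i => (Fact.out : (p i).Prime).two_le
  have hP1 : 1 < P := by
    obtain ⟨i⟩ := ‹Nonempty ι›
    exact (hp2 i).trans (hP i)
  have hT0 : 0 < T := by linarith
  obtain ⟨L, hL1, hL2, hL3⟩ := exists_finset_exponents hp2 hP1 hH
  let F : (∀ i, ℤ_[p i]) × (ι → ℕ) → Finset ℤ := fun q =>
    s.filter fun x => ∀ i, (p i : ℤ_[p i]) ^ q.2 i ∣ (x : ℤ_[p i]) - q.1 i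
  have hcov : s ⊆ (Fintype.piFinset A ×ˢ L).biUnion F := by
    intro x hx
    obtain ⟨-, y, hy, k, hk, hTk⟩ := hs x hx
    obtain ⟨l, hlk, hl1, hl2⟩ := exists_le_prod_pow_lt hP hP1 hT k hTk
    exact Finset.mem_biUnion.2 ⟨(y, l),
      Finset.mem_product.2 ⟨Fintype.mem_piFinset.2 hy, hL2 l hl1 hl2⟩,
      Finset.mem_filter.2 ⟨hx, fun i => (pow_dvd_pow _ (hlk i)).trans (hk i)⟩⟩
  calc (s.card : ℝ) ≤ (((Fintype.piFinset A ×ˢ L).biUnion F).card : ℝ) := by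
        exact_mod_cast Finset.card_le_card hcov
    _ ≤ ∑ q ∈ Fintype.piFinset A ×ˢ L, ((F q).card : ℝ) := by
        exact_mod_cast Finset.card_biUnion_le
    _ ≤ ∑ q ∈ Fintype.piFinset A ×ˢ L, (2 * B / T + 2) := by
        refine Finset.sum_le_sum fun q hq => ?_
        refine card_intBox_filter_pow_dvd_le hp q.1 q.2 hB hT0
          (hL1 _ (Finset.mem_product.1 hq).2) _ fun x hx => ?_
        exact ⟨(hs x (Finset.mem_filter.1 hx).1).1, (Finset.mem_filter.1 hx).2⟩
    _ = (∏ i, (A i).card : ℕ) * (L.card : ℝ) * (2 * B / T + 2) := by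
        rw [Finset.sum_const, Finset.card_product, Fintype.card_piFinset, nsmul_eq_mul]
        push_cast
        ring
    _ ≤ _ := by
        have : (L.card : ℝ) ≤ (P * H ^ (Fintype.card ι - 1) : ℕ) := by exact_mod_cast hL3
        gcongr

theorem exists_exponent_of_prod_le {a U : ℝ} (ha : 0 < a) (haU : a ≤ U) {q : ℕ} (hq : 1 < q) :
    ∃ n : ℕ, U ≤ a * q ^ n ∧ a * q ^ n ≤ U * q := by
  obtain ⟨n, h1, h2⟩ := exists_nat_pow_near ((one_le_div ha).2 haU)
    (by exact_mod_cast hq : (1 : ℝ) < q)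
  rw [le_div_iff₀ ha] at h1
  rw [div_lt_iff₀ ha] at h2
  -- One step past the last power below `U / a` overshoots by at most a factor `q`.
  refine ⟨n + 1, by linarith, ?_⟩
  rw [pow_succ, ← mul_assoc]
  gcongr
  linarith

theorem exists_update_prod_bounds [DecidableEq ι] {U : ℝ} {H : ℕ}
    (hU : ((∏ i, p i : ℕ) : ℝ) ^ H ≤ U) (i₀ : ι) {l : ι → ℕ} (hl₀ : l i₀ = 0) (hl : ∀ i, l i ≤ H) :
    ∃ n : ℕ, U ≤ ∏ i, (p i : ℝ) ^ Function.update l i₀ n i ∧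
      ∏ i, (p i : ℝ) ^ Function.update l i₀ n i ≤ U * p i₀ := by
  have hp1 : ∀ i, 1 ≤ p i := fun i => (Fact.out : (p i).Prime).pos
  have ha : ∏ i, (p i : ℝ) ^ l i ≤ U := by
    refine le_trans ?_ hU
    rw [Nat.cast_prod, ← Finset.prod_pow]
    refine Finset.prod_le_prod (fun i _ => by positivity) fun i _ => ?_
    exact pow_le_pow_right₀ (by exact_mod_cast hp1 i) (hl i)
  have hpos : 0 < ∏ i, (p i : ℝ) ^ l i := Finset.prod_pos fun i _ =>
    pow_pos (by exact_mod_cast hp1 i) _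
  obtain ⟨n, h1, h2⟩ := exists_exponent_of_prod_le hpos ha (Fact.out : (p i₀).Prime).one_lt
  refine ⟨n, ?_⟩
  have : ∏ i, (p i : ℝ) ^ Function.update l i₀ n i = (∏ i, (p i : ℝ) ^ l i) * (p i₀ : ℝ) ^ n := by
    rw [← Finset.mul_prod_erase _ _ (Finset.mem_univ i₀),
      ← Finset.mul_prod_erase _ (fun j => (p j : ℝ) ^ l j) (Finset.mem_univ i₀),
      Finset.prod_congr rfl fun j hj => by rw [Function.update_of_ne (Finset.ne_of_mem_erase hj)],
      hl₀, Function.update_self]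
    ring
  rw [this]
  exact ⟨h1, h2⟩

/-- The coordinates other than `i₀` range freely below `H`; the exponent at `i₀` then fills the
product up to `U`. -/
theorem exists_finset_close [Nonempty ι] (hp : Function.Injective p) {P : ℕ} (hP : ∀ i, p i ≤ P)
    (y : ∀ i, ℤ_[p i]) {B U : ℝ} {H : ℕ} (hU : ((∏ i, p i : ℕ) : ℝ) ^ H ≤ U)
    (hB : 2 * (U * P * (∏ i, p i : ℕ)) ≤ B) :
    ∃ s : Finset ℤ, (∀ x ∈ s, |(x : ℝ)| ≤ B ∧ ∃ k : ι → ℕ,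
      (∀ i, (p i : ℤ_[p i]) ^ k i ∣ (x : ℤ_[p i]) - y i) ∧ U ≤ ∏ i, (p i : ℝ) ^ k i) ∧
      (H : ℝ) ^ (Fintype.card ι - 1) * (B / (U * P * (∏ i, p i : ℕ))) ≤ s.card := by
  classical
  have hp1 : ∀ i, 1 ≤ p i := fun i => (Fact.out : (p i).Prime).pos
  obtain ⟨i₀⟩ := ‹Nonempty ι›
  let Λ : Finset (ι → ℕ) := Fintype.piFinset fun i => Finset.range (if i = i₀ then 1 else H)
  have hΛ0 : ∀ l ∈ Λ, l i₀ = 0 := fun l hl => by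
    simpa using Fintype.mem_piFinset.1 hl i₀
  have hΛH : ∀ l ∈ Λ, ∀ i, l i ≤ H := fun l hl i => by
    have := Finset.mem_range.1 (Fintype.mem_piFinset.1 hl i)
    split_ifs at this <;> omega
  have hΛcard : Λ.card = H ^ (Fintype.card ι - 1) := by
    simp only [Λ, Fintype.card_piFinset, Finset.card_range]
    rw [prod_ite_eq_mul_pow, one_mul]
  have hn : ∀ l : ι → ℕ, ∃ n : ℕ, l ∈ Λ → U ≤ ∏ i, (p i : ℝ) ^ Function.update l i₀ n i ∧
      ∏ i, (p i : ℝ) ^ Function.update l i₀ n i ≤ U * p i₀ := by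
    intro l
    by_cases hl : l ∈ Λ
    · obtain ⟨n, h⟩ := exists_update_prod_bounds hU i₀ (hΛ0 l hl) (hΛH l hl)
      exact ⟨n, fun _ => h⟩
    · exact ⟨0, fun h => absurd h hl⟩
  choose n hn using hn
  let κ : (ι → ℕ) → ι → ℕ := fun l => Function.update l i₀ (n l)
  -- Aiming at `y + p ^ κ` modulo `p ^ (κ + 1)` forces `x - y` to have order exactly `κ`. Hence `x`
  -- determines its exponent vector and the classes are disjoint.
  choose x₀ hx₀ using fun l : ι → ℕ =>
    exists_int_pow_dvd_sub hp (fun i => y i + (p i : ℤ_[p i]) ^ κ l i) (fun i => κ l i + 1)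
  let M : (ι → ℕ) → ℕ := fun l => ∏ i, p i ^ (κ l i + 1)
  let F : (ι → ℕ) → Finset ℤ := fun l => (intBox B).filter fun x => x ≡ x₀ l [ZMOD M l]
  have hmem : ∀ l, ∀ x ∈ F l, ∀ i, (p i : ℤ_[p i]) ^ (κ l i + 1) ∣
      (x : ℤ_[p i]) - (y i + (p i : ℤ_[p i]) ^ κ l i) := fun l x hx =>
    pow_dvd_sub_of_modEq _ _ (hx₀ l) (Finset.mem_filter.1 hx).2
  have hdvd : ∀ l, ∀ x ∈ F l, ∀ i, (p i : ℤ_[p i]) ^ κ l i ∣ (x : ℤ_[p i]) - y i := by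
    intro l x hx i
    have h := dvd_add ((pow_dvd_pow _ (Nat.le_succ _)).trans (hmem l x hx i)) (dvd_refl _)
    rwa [sub_add_eq_sub_sub, sub_add_cancel] at h
  have hndvd : ∀ l, ∀ x ∈ F l, ∀ i, ¬ (p i : ℤ_[p i]) ^ (κ l i + 1) ∣ (x : ℤ_[p i]) - y i := by
    intro l x hx i hd
    have h := dvd_sub hd (hmem l x hx i)
    rw [sub_add_eq_sub_sub, sub_sub_cancel] at h
    have hpne : (p i : ℤ_[p i]) ≠ 0 := by exact_mod_cast (Fact.out : (p i).Prime).ne_zero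
    have := (pow_dvd_pow_iff hpne PadicInt.prime_p.not_isUnit).1 h
    omega
  have hMpos : ∀ l, 0 < M l := fun l => Finset.prod_pos fun i _ => pow_pos (hp1 i) _
  have hMle : ∀ l ∈ Λ, (M l : ℝ) ≤ U * P * (∏ i, p i : ℕ) := by
    intro l hl
    have : (M l : ℝ) = (∏ i, (p i : ℝ) ^ κ l i) * (∏ i, p i : ℕ) := by
      simp only [M, pow_succ, Finset.prod_mul_distrib]
      push_cast
      rfl
    rw [this]
    have hU0 : 0 ≤ U := le_trans (by positivity) hU
    have : (p i₀ : ℝ) ≤ P := by exact_mod_cast hP i₀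
    exact mul_le_mul_of_nonneg_right ((hn l hl).2.trans (by gcongr)) (by positivity)
  have hdisj : (Λ : Set (ι → ℕ)).PairwiseDisjoint F := by
    intro l hl l' hl' hne
    refine Finset.disjoint_left.2 fun x hx hx' => hne ?_
    have hκ : ∀ i, κ l i = κ l' i := by
      intro i
      by_contra hcon
      rcases Nat.lt_or_gt_of_ne hcon with h | h
      · exact hndvd l x hx i ((pow_dvd_pow _ h).trans (hdvd l' x hx' i))
      · exact hndvd l' x hx' i ((pow_dvd_pow _ h).trans (hdvd l x hx i))
    funext i
    by_cases hi : i = i₀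
    · rw [hi, hΛ0 l hl, hΛ0 l' hl']
    · simpa [κ, hi] using hκ i
  refine ⟨Λ.biUnion F, fun x hx => ?_, ?_⟩
  · obtain ⟨l, hl, hx⟩ := Finset.mem_biUnion.1 hx
    exact ⟨mem_intBox.1 (Finset.mem_filter.1 hx).1, κ l, hdvd l x hx, (hn l hl).1⟩
  · rw [Finset.card_biUnion hdisj, ← Nat.cast_pow, ← hΛcard, ← nsmul_eq_mul, ← Finset.sum_const,
      Nat.cast_sum]
    refine Finset.sum_le_sum fun l hl => ?_
    have hMl := hMle l hl
    have hMl0 : (0 : ℝ) < M l := by exact_mod_cast hMpos l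
    have hB0 : 0 ≤ B := by linarith
    refine le_trans (by gcongr) (le_card_intBox_filter_modEq (hMpos l) (by linarith) (x₀ l))

end Approximation

/-! ### Archimedean size of polynomial values. -/

section Growth

variable {f : ℤ[X]}

theorem exists_abs_eval_le (f : ℤ[X]) :
    ∃ C : ℝ, 0 < C ∧ ∀ B : ℝ, 1 ≤ B → ∀ x : ℤ, |(x : ℝ)| ≤ B →
      |((f.eval x : ℤ) : ℝ)| ≤ C * B ^ f.natDegree := by
  refine ⟨∑ i ∈ Finset.range (f.natDegree + 1), |(f.coeff i : ℝ)| + 1, by positivity,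
    fun B hB x hx => ?_⟩
  rw [eval_eq_sum_range, Int.cast_sum]
  calc |∑ i ∈ Finset.range (f.natDegree + 1), ((f.coeff i * x ^ i : ℤ) : ℝ)|
      ≤ ∑ i ∈ Finset.range (f.natDegree + 1), |((f.coeff i * x ^ i : ℤ) : ℝ)| :=
        Finset.abs_sum_le_sum_abs _ _
    _ ≤ ∑ i ∈ Finset.range (f.natDegree + 1), |(f.coeff i : ℝ)| * B ^ f.natDegree := by
        refine Finset.sum_le_sum fun i hi => ?_
        push_cast
        rw [abs_mul, abs_pow]
        gcongr
        calc |(x : ℝ)| ^ i ≤ B ^ i := by gcongr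
          _ ≤ B ^ f.natDegree := pow_le_pow_right₀ hB (Finset.mem_range_succ_iff.1 hi)
    _ ≤ _ := by
        rw [← Finset.sum_mul]
        gcongr
        linarith

theorem exists_le_abs_eval (hf : f ≠ 0) :
    ∃ c : ℝ, 0 < c ∧ ∃ X₀ : ℝ, ∀ x : ℤ, X₀ ≤ |(x : ℝ)| →
      c * |(x : ℝ)| ^ f.natDegree ≤ |((f.eval x : ℤ) : ℝ)| := by
  have key : ∀ g : ℝ[X], g ≠ 0 → ∃ C : ℝ, 0 < C ∧ ∃ X₀ : ℝ, ∀ t, X₀ ≤ t →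
      |t| ^ g.natDegree ≤ C * |g.eval t| := by
    intro g hg
    have h := isBigO_atTop_of_degree_le ((X : ℝ[X]) ^ g.natDegree) g
      (by rw [degree_X_pow, degree_eq_natDegree hg])
    obtain ⟨C, hC, hb⟩ := h.exists_pos
    obtain ⟨X₀, hX⟩ := eventually_atTop.1 hb.bound
    exact ⟨C, hC, X₀, fun t ht => by simpa using hX t ht⟩
  set g := f.map (Int.castRingHom ℝ) with hg
  have hinj : Function.Injective (Int.castRingHom ℝ) := RingHom.injective_int _
  have hg0 : g ≠ 0 := (Polynomial.map_ne_zero_iff hinj).2 hf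
  have hdeg : g.natDegree = f.natDegree := natDegree_map_eq_of_injective hinj f
  have heval : ∀ x : ℤ, g.eval (x : ℝ) = ((f.eval x : ℤ) : ℝ) := fun x => by
    rw [hg, ← eq_intCast (Int.castRingHom ℝ) x, eval_map, eval₂_at_apply, eq_intCast]
  have hdeg' : (g.comp (-X)).natDegree = f.natDegree := by
    rw [natDegree_comp, natDegree_neg, natDegree_X, mul_one, hdeg]
  have hg0' : g.comp (-X) ≠ 0 := by
    intro h
    apply hg0
    have := congrArg (fun q => q.comp (-X)) h
    simpa [comp_assoc] using this
  obtain ⟨C₁, hC₁, X₁, h₁⟩ := key g hg0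
  obtain ⟨C₂, hC₂, X₂, h₂⟩ := key _ hg0'
  rw [hdeg] at h₁
  rw [hdeg'] at h₂
  refine ⟨(max C₁ C₂)⁻¹, by positivity, max X₁ X₂, fun x hx => ?_⟩
  rw [inv_mul_eq_div, div_le_iff₀ (by positivity), mul_comm, ← heval]
  rcases abs_choice (x : ℝ) with hx' | hx'
  · have := h₁ x (by rw [← hx']; exact (le_max_left _ _).trans hx)
    exact this.trans (by gcongr; exact le_max_left _ _)
  · have := h₂ (-x) (by rw [← hx']; exact (le_max_right _ _).trans hx)
    rw [abs_neg, eval_comp, eval_neg, eval_X, neg_neg] at this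
    exact this.trans (by gcongr; exact le_max_right _ _)

end Growth

/-! ### The `S`-part in terms of simultaneous approximation. -/

section SPart

variable {f : ℤ[X]} {S : Finset ℕ}

theorem prod_rootPrimes_le_sPart (hS : ∀ p ∈ S, p.Prime) (y : ℤ) :
    ∏ i : rootPrimes f S, (i : ℕ) ^ padicValInt i y ≤ sPart S y := by
  classical
  rw [Finset.prod_coe_sort (rootPrimes f S) fun p => p ^ padicValInt p y]
  refine Finset.prod_le_prod_of_subset_of_one_le' (Finset.filter_subset _ _) fun p hp _ => ?_
  exact Nat.one_le_pow _ _ (hS p hp).pos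

variable [∀ i : rootPrimes f S, Fact (i : ℕ).Prime]

theorem prod_pow_le_sPart_eval (hS : ∀ p ∈ S, p.Prime) {R : ℕ} {y : ∀ i : rootPrimes f S, ℤ_[i]}
    (hy : ∀ i : rootPrimes f S, (f.map (Int.castRingHom ℤ_[i])).rootMultiplicity (y i) = R) {x : ℤ}
    (hx : f.eval x ≠ 0) {k : rootPrimes f S → ℕ}
    (hk : ∀ i : rootPrimes f S, ((i : ℕ) : ℤ_[i]) ^ k i ∣ (x : ℤ_[i]) - y i) :
    (∏ i : rootPrimes f S, ((i : ℕ) : ℝ) ^ k i) ^ R ≤ sPart S (f.eval x) := by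
  refine le_trans ?_ (Nat.cast_le.2 (prod_rootPrimes_le_sPart (f := f) hS (f.eval x)))
  rw [← Finset.prod_pow]
  push_cast
  refine Finset.prod_le_prod (fun i _ => by positivity) fun i _ => ?_
  rw [← pow_mul]
  refine pow_le_pow_right₀ (by exact_mod_cast (Fact.out : (i : ℕ).Prime).pos) ?_
  rw [← hy i]
  exact mul_rootMultiplicity_le_padicValInt_eval hx (hk i)

theorem exists_sPart_eval_le (hS : ∀ p ∈ S, p.Prime) (hf : f ≠ 0) {R : ℕ}
    (hR : ∀ (i : rootPrimes f S) (y : ℤ_[i]),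
      (f.map (Int.castRingHom ℤ_[i])).rootMultiplicity y ≤ R) :
    ∃ (A : ∀ i : rootPrimes f S, Finset ℤ_[i]) (C : ℝ), 0 < C ∧ ∀ x : ℤ, f.eval x ≠ 0 →
      ∃ y : ∀ i : rootPrimes f S, ℤ_[i], (∀ i, y i ∈ A i) ∧ ∃ k : rootPrimes f S → ℕ,
        (∀ i : rootPrimes f S, ((i : ℕ) : ℤ_[i]) ^ k i ∣ (x : ℤ_[i]) - y i) ∧
        (sPart S (f.eval x) : ℝ) ≤ C * (∏ i : rootPrimes f S, ((i : ℕ) : ℝ) ^ k i) ^ R := by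
  classical
  choose A C hC h using fun i : rootPrimes f S => exists_pow_padicValInt_eval_le hf (hR i)
  -- Without a `p`-adic root all multiplicities are zero, and the local estimate with `r = 0` bounds
  -- the `p`-part.
  have h' : ∀ p : ℕ, ∃ c : ℝ, 0 < c ∧ (p ∈ S → ¬ HasPadicRoot f p → ∀ x : ℤ, f.eval x ≠ 0 →
      (p : ℝ) ^ padicValInt p (f.eval x) ≤ c) := by
    intro p
    by_cases hp : p ∈ S ∧ ¬ HasPadicRoot f p
    · have : Fact p.Prime := ⟨hS p hp.1⟩
      obtain ⟨_, c, hc, hx⟩ := exists_pow_padicValInt_eval_le hf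
        fun y : ℤ_[p] => (rootMultiplicity_eq_zero_of_not_hasPadicRoot hp.2 y).le
      refine ⟨c, hc, fun _ _ x hfx => ?_⟩
      obtain ⟨_, _, _, _, hle⟩ := hx x hfx
      simpa using hle
    · exact ⟨1, one_pos, fun h1 h2 => absurd ⟨h1, h2⟩ hp⟩
  choose c hc hcle using h'
  refine ⟨A, (∏ i, C i) * ∏ p ∈ S with ¬ HasPadicRoot f p, c p,
    mul_pos (Finset.prod_pos fun i _ => hC i) (Finset.prod_pos fun p _ => hc p), fun x hx => ?_⟩
  choose y hyA k hk hle using fun i => h i x hx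
  refine ⟨y, hyA, k, hk, ?_⟩
  have hsplit : (sPart S (f.eval x) : ℝ) =
      (∏ i : rootPrimes f S, ((i : ℕ) : ℝ) ^ padicValInt i (f.eval x)) *
        ∏ p ∈ S with ¬ HasPadicRoot f p, (p : ℝ) ^ padicValInt p (f.eval x) := by
    rw [Finset.prod_coe_sort (rootPrimes f S) fun p => (p : ℝ) ^ padicValInt p (f.eval x)]
    rw [sPart, ← Finset.prod_filter_mul_prod_filter_not S (HasPadicRoot f)]
    push_cast
    congr!
  rw [hsplit, mul_right_comm, ← Finset.prod_pow, ← Finset.prod_mul_distrib]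
  refine mul_le_mul (Finset.prod_le_prod (fun i _ => by positivity) fun i _ => hle i)
    (Finset.prod_le_prod (fun i _ => by positivity) fun p hp => ?_) (by positivity)
    (Finset.prod_nonneg fun i _ => mul_nonneg (hC i).le (by positivity))
  rw [Finset.mem_filter] at hp
  exact hcle p hp.1 hp.2 x hx

end SPart

/-! ### The counting function as a finite cardinality. -/

section Count

theorem countN_eq_card (f : ℤ[X]) (S : Finset ℕ) {ε : ℝ} (hε : 0 < ε) (B : ℝ) :
    ∃ s : Finset ℤ, s.card = countN f S ε B ∧ ∀ x, x ∈ s ↔ |(x : ℝ)| ≤ B ∧ f.eval x ≠ 0 ∧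
      |((f.eval x : ℤ) : ℝ)| ^ ε ≤ sPart S (f.eval x) := by
  classical
  let s := (intBox B).filter fun x => f.eval x ≠ 0 ∧
      |((f.eval x : ℤ) : ℝ)| ^ ε ≤ sPart S (f.eval x)
  have hs : ∀ x, x ∈ s ↔ |(x : ℝ)| ≤ B ∧ f.eval x ≠ 0 ∧
      |((f.eval x : ℤ) : ℝ)| ^ ε ≤ sPart S (f.eval x) := fun x => by
    rw [Finset.mem_filter, mem_intBox]
  refine ⟨s, ?_, hs⟩
  rw [countN, ← Set.ncard_coe_finset]
  congr 1
  ext x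
  rw [Finset.mem_coe, hs, Set.mem_ofPred_eq]
  have : 0 < |((f.eval x : ℤ) : ℝ)| ^ ε ↔ f.eval x ≠ 0 := by
    refine ⟨fun h h0 => ?_, fun h => Real.rpow_pos_of_pos (by simpa using h) _⟩
    simp [h0, Real.zero_rpow hε.ne'] at h
  rw [this]

theorem countN_mono (f : ℤ[X]) (S : Finset ℕ) {ε : ℝ} (hε : 0 < ε) {B B' : ℝ} (h : B ≤ B') :
    countN f S ε B ≤ countN f S ε B' := by
  obtain ⟨s, hs, hs'⟩ := countN_eq_card f S hε B
  obtain ⟨t, ht, ht'⟩ := countN_eq_card f S hε B'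
  rw [← hs, ← ht]
  refine Finset.card_le_card fun x hx => ?_
  rw [ht']
  rw [hs'] at hx
  exact ⟨hx.1.trans h, hx.2⟩

end Count

/-! ### Dyadic summation and comparison of powers. -/

section Analysis

theorem eventually_le_of_le_half_add {F : ℝ → ℝ} (hF : Monotone F) {a C : ℝ} (ha : 0 < a)
    (hC : 0 ≤ C) {m : ℕ}
    (h : ∀ᶠ B in atTop, F B ≤ F (B / 2) + C * (B ^ a * Real.log B ^ m)) :
    ∃ A : ℝ, ∀ᶠ B in atTop, F B ≤ A * (B ^ a * Real.log B ^ m) := by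
  obtain ⟨B₀, hB₀⟩ := eventually_atTop.1 h
  set B₁ := max B₀ 4 with hB₁
  set g : ℝ → ℝ := fun B => B ^ a * Real.log B ^ m with hg
  have hq : (2 : ℝ) ^ (-a) < 1 := Real.rpow_lt_one_of_one_lt_of_neg one_lt_two (by linarith)
  set q := (2 : ℝ) ^ (-a) with hqdef
  have hq0 : 0 < q := by positivity
  -- The fixed point of `A = A q + C`, as halving `B` shrinks the main term by at least the factor
  -- `q`.
  set A := C / (1 - q) with hA
  have hA0 : 0 ≤ A := div_nonneg hC (by linarith)
  have hAq : A * q + C = A := by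
    have : A * (1 - q) = C := div_mul_cancel₀ _ (by linarith)
    linarith
  have hlog : ∀ B, B₁ ≤ B → 1 ≤ Real.log B := fun B hB => by
    rw [Real.le_log_iff_exp_le (by linarith [le_max_right B₀ 4])]
    linarith [Real.exp_one_lt_d9, le_max_right B₀ 4]
  have hgone : ∀ B, B₁ ≤ B → 1 ≤ g B := fun B hB =>
    one_le_mul_of_one_le_of_one_le
      (Real.one_le_rpow (by linarith [le_max_right B₀ 4]) ha.le) (one_le_pow₀ (hlog B hB))
  have hghalf : ∀ B, B₁ ≤ B → g (B / 2) ≤ q * g B := fun B hB => by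
    have hB4 : 4 ≤ B := (le_max_right _ _).trans hB
    have h1 : (B / 2) ^ a = q * B ^ a := by
      rw [Real.div_rpow (by linarith) zero_le_two, hqdef, Real.rpow_neg zero_le_two]
      ring
    have h2 : 0 ≤ Real.log (B / 2) := Real.log_nonneg (by linarith)
    have h3 : Real.log (B / 2) ≤ Real.log B := Real.log_le_log (by linarith) (by linarith)
    simp only [hg]
    rw [h1, mul_assoc]
    gcongr
  have key : ∀ n : ℕ, ∀ B, B₁ ≤ B → B < 2 ^ n * B₁ → F B ≤ F B₁ + A * g B := by
    intro n
    induction n with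
    | zero => intro B hB hB'; simp at hB'; linarith
    | succ n ih =>
      intro B hB hB'
      have hstep := hB₀ B ((le_max_left _ _).trans hB)
      change F B ≤ F (B / 2) + C * g B at hstep
      have hgB := hgone B hB
      rcases le_or_gt B₁ (B / 2) with hle | hlt
      · have h1 := ih (B / 2) hle (by rw [pow_succ] at hB'; linarith)
        have h2 := mul_le_mul_of_nonneg_left (hghalf B hB) hA0
        have h3 : A * g B = A * (q * g B) + C * g B := by
          linear_combination (-(g B)) * hAq
        linarith
      · have h1 := hF hlt.le
        have h2 : C * g B ≤ A * g B := by
          gcongr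
          nlinarith
        linarith
  refine ⟨|F B₁| + A, ?_⟩
  filter_upwards [eventually_ge_atTop B₁] with B hB
  have hBpos : 0 < B₁ := by linarith [le_max_right B₀ 4]
  obtain ⟨n, hn⟩ := pow_unbounded_of_one_lt (B / B₁) (one_lt_two : (1 : ℝ) < 2)
  have h1 := key n B hB ((div_lt_iff₀ hBpos).1 hn)
  have h2 : F B₁ ≤ |F B₁| * g B :=
    (le_abs_self _).trans (le_mul_of_one_le_right (abs_nonneg _) (hgone B hB))
  change F B ≤ (|F B₁| + A) * g B
  linarith

theorem eventually_const_mul_rpow_le {a b : ℝ} (hab : a < b) (c : ℝ) {d : ℝ} (hd : 0 < d) :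
    ∀ᶠ B : ℝ in atTop, c * B ^ a ≤ d * B ^ b := by
  filter_upwards [(tendsto_rpow_atTop (sub_pos.2 hab)).eventually_ge_atTop (c / d),
    eventually_gt_atTop 0] with B hB hB0
  rw [div_le_iff₀ hd, Real.rpow_sub hB0, div_mul_eq_mul_div,
    le_div_iff₀ (Real.rpow_pos_of_pos hB0 _)] at hB
  linarith

end Analysis

/-! ### The upper and lower bounds for the count. -/

section Bounds

variable {f : ℤ[X]} {S : Finset ℕ} [∀ i : rootPrimes f S, Fact (i : ℕ).Prime]

theorem exists_eventually_countN_le (hS : ∀ p ∈ S, p.Prime) (hf : f ≠ 0)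
    (hs' : 1 ≤ (rootPrimes f S).card) {R : ℕ} (hR0 : 1 ≤ R)
    (hR : ∀ (i : rootPrimes f S) (y : ℤ_[i]),
      (f.map (Int.castRingHom ℤ_[i])).rootMultiplicity y ≤ R)
    {ε : ℝ} (hε₀ : 0 < ε) {θ : ℝ} (hθ : θ = f.natDegree * ε / R) (hθ0 : 0 < θ) (hθ1 : θ < 1) :
    ∃ A : ℝ, ∀ᶠ B : ℝ in atTop, (countN f S ε B : ℝ) ≤
      A * (B ^ (1 - θ) * Real.log B ^ ((rootPrimes f S).card - 1)) := by
  classical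
  have : Nonempty (rootPrimes f S) := (Finset.card_pos.1 hs').to_subtype
  obtain ⟨A, C, hC, hA⟩ := exists_sPart_eval_le hS hf hR
  obtain ⟨c, hc, X₀, hX₀⟩ := exists_le_abs_eval hf
  set n := f.natDegree
  set P := (rootPrimes f S).sup id with hPdef
  have hP : ∀ i : rootPrimes f S, (i : ℕ) ≤ P := fun i => Finset.le_sup (f := id) i.2
  have hRpos : (0 : ℝ) < R := by exact_mod_cast hR0
  set D := (c * (1 / 2) ^ n) ^ ε / C with hD
  have hDpos : 0 < D := by positivity
  -- Chosen so that `T = t B ^ θ` is the least product compatible with `|f(x)| ≥ c (B / 2) ^ n`.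
  set t := D ^ (1 / (R : ℝ)) with ht
  have htpos : 0 < t := by positivity
  have hTpow : ∀ B : ℝ, 0 < B → (t * B ^ θ) ^ R = (c * (B / 2) ^ n) ^ ε / C := by
    intro B hB
    rw [mul_pow, ht, ← Real.rpow_mul_natCast hDpos.le, ← Real.rpow_mul_natCast hB.le, hθ,
      one_div, inv_mul_cancel₀ hRpos.ne', Real.rpow_one, div_mul_cancel₀ _ hRpos.ne', hD,
      Real.rpow_mul hB.le, Real.rpow_natCast, div_mul_eq_mul_div,
      ← Real.mul_rpow (by positivity) (by positivity), mul_assoc, ← mul_pow]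
    congr 4
    ring
  have hs : Fintype.card (rootPrimes f S) = (rootPrimes f S).card := Fintype.card_coe _
  set m := (rootPrimes f S).card - 1 with hm
  have hE : (0 : ℝ) ≤ (∏ i, (A i).card : ℕ) := Nat.cast_nonneg _
  set E : ℝ := ((∏ i, (A i).card : ℕ) : ℝ) with hEdef
  clear_value E t D P m n
  refine eventually_le_of_le_half_add (C := E * (P * 3 ^ m) * (4 / t))
    (fun B B' h => Nat.cast_le.2 (countN_mono f S hε₀ h)) (sub_pos.2 hθ1) (by positivity) ?_
  filter_upwards [eventually_ge_atTop (2 * X₀), eventually_ge_atTop 3,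
    eventually_const_mul_rpow_le hθ0 1 htpos, eventually_const_mul_rpow_le hθ1 (t * P) one_pos,
    eventually_const_mul_rpow_le hθ1 t one_pos]
    with B hBX hB3 hT1 hTP hTB
  rw [Real.rpow_zero, one_mul] at hT1
  rw [Real.rpow_one, one_mul] at hTP hTB
  have hB0 : 0 < B := by linarith
  obtain ⟨s, hs1, hs2⟩ := countN_eq_card f S hε₀ B
  obtain ⟨s', hs1', hs2'⟩ := countN_eq_card f S hε₀ (B / 2)
  have hlog : 1 ≤ Real.log B := by
    rw [Real.le_log_iff_exp_le hB0]
    linarith [Real.exp_one_lt_d9]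
  -- As `2 log 2 > 1`, this gives `2 ^ H ≥ B`, which exceeds the top of the window.
  set H := ⌈2 * Real.log B⌉₊ with hH
  have hH1 : (H : ℝ) ≤ 3 * Real.log B := by
    linarith [Nat.ceil_lt_add_one (a := 2 * Real.log B) (by linarith)]
  have hH2 : t * B ^ θ * P ≤ 2 ^ H := by
    calc t * B ^ θ * P ≤ B := by linarith
      _ = Real.exp (Real.log B) := (Real.exp_log hB0).symm
      _ ≤ Real.exp (Real.log 2 * H) := by
        apply Real.exp_le_exp.2
        have := Nat.le_ceil (2 * Real.log B)
        nlinarith [Real.log_two_gt_d9]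
      _ = 2 ^ H := by rw [← Real.rpow_def_of_pos two_pos, Real.rpow_natCast]
  have hcard := card_close_le (p := fun i : rootPrimes f S => (i : ℕ)) Subtype.val_injective hP A
    hB0.le hT1 hH2 (s \ s') (by
      intro x hx
      rw [Finset.mem_sdiff, hs2, hs2'] at hx
      obtain ⟨⟨hxB, hfx, hle⟩, hx'⟩ := hx
      have hxB' : B / 2 < |(x : ℝ)| := by
        by_contra! hcon
        exact hx' ⟨hcon, hfx, hle⟩
      obtain ⟨y, hyA, k, hk, hsP⟩ := hA x hfx
      refine ⟨hxB, y, hyA, k, hk, ?_⟩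
      rw [← pow_le_pow_iff_left₀ (by positivity) (by positivity) (by omega : R ≠ 0), hTpow B hB0,
        div_le_iff₀ hC, mul_comm _ C]
      refine le_trans ?_ (hle.trans hsP)
      refine Real.rpow_le_rpow (by positivity) ?_ hε₀.le
      refine le_trans ?_ (hX₀ x (by linarith))
      gcongr)
  have hsub : (countN f S ε B : ℝ) ≤ countN f S ε (B / 2) + ((s \ s').card : ℝ) := by
    rw [← hs1, ← hs1']
    have := Finset.card_le_card_sdiff_add_card (s := s) (t := s')
    have h' : (s.card : ℝ) ≤ (s \ s').card + s'.card := by exact_mod_cast this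
    linarith
  refine hsub.trans (add_le_add_right (hcard.trans ?_) _)
  rw [hs, ← hm, ← hEdef]
  have h4 : 2 * B / (t * B ^ θ) + 2 ≤ 4 / t * B ^ (1 - θ) := by
    have hpos : 0 < t * B ^ θ := by positivity
    have h5 : 2 ≤ 2 * B / (t * B ^ θ) := by
      rw [le_div_iff₀ hpos]
      linarith
    have h6 : 4 / t * B ^ (1 - θ) = 2 * (2 * B / (t * B ^ θ)) := by
      rw [Real.rpow_sub hB0, Real.rpow_one]
      field_simp
      norm_num
    linarith
  calc E * (P * H ^ m : ℕ) * (2 * B / (t * B ^ θ) + 2)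
      ≤ E * (P * (3 * Real.log B) ^ m) * (4 / t * B ^ (1 - θ)) := by
        push_cast
        gcongr
    _ = _ := by ring

theorem exists_eventually_le_countN (hS : ∀ p ∈ S, p.Prime) (hf : f ≠ 0)
    (hs' : 1 ≤ (rootPrimes f S).card) {R : ℕ} (hR0 : 1 ≤ R)
    (hR : ∀ i : rootPrimes f S, ∃ y : ℤ_[i],
      (f.map (Int.castRingHom ℤ_[i])).rootMultiplicity y = R)
    {ε : ℝ} (hε₀ : 0 < ε) {θ : ℝ} (hθ : θ = f.natDegree * ε / R) (hθ0 : 0 < θ) (hθ1 : θ < 1) :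
    ∃ A : ℝ, 0 < A ∧ ∀ᶠ B : ℝ in atTop,
      A * (B ^ (1 - θ) * Real.log B ^ ((rootPrimes f S).card - 1)) ≤ countN f S ε B := by
  classical
  have : Nonempty (rootPrimes f S) := (Finset.card_pos.1 hs').to_subtype
  choose y hy using hR
  obtain ⟨C, hC, hCf⟩ := exists_abs_eval_le f
  set n := f.natDegree
  set P := (rootPrimes f S).sup id with hPdef
  have hP : ∀ i : rootPrimes f S, (i : ℕ) ≤ P := fun i => Finset.le_sup (f := id) i.2
  have hi2 : ∀ i : rootPrimes f S, 2 ≤ (i : ℕ) := fun i => (Fact.out : (i : ℕ).Prime).two_le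
  have hP0 : (0 : ℝ) < P := by
    obtain ⟨i⟩ := ‹Nonempty (rootPrimes f S)›
    have := (hi2 i).trans (hP i)
    exact_mod_cast (by omega : 0 < P)
  set Q := ∏ i : rootPrimes f S, (i : ℕ) with hQdef
  have hQ2 : 2 ≤ Q := by
    obtain ⟨i⟩ := ‹Nonempty (rootPrimes f S)›
    exact (hi2 i).trans (Finset.single_le_prod' (f := fun i : rootPrimes f S => (i : ℕ))
      (fun j _ => by linarith [hi2 j]) (Finset.mem_univ i))
  have hQ2' : (2 : ℝ) ≤ Q := by exact_mod_cast hQ2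
  have hQ0 : (0 : ℝ) < Q := by linarith
  have hlogQ : 0 < Real.log Q := Real.log_pos (by linarith)
  have hRpos : (0 : ℝ) < R := by exact_mod_cast hR0
  -- Makes `U = u B ^ θ` satisfy `U ^ R = (C B ^ n) ^ ε`, an upper bound for `|f(x)| ^ ε`.
  set u := (C ^ ε) ^ (1 / (R : ℝ)) with hu
  have hupos : 0 < u := by positivity
  have hUpow : ∀ B : ℝ, 0 < B → (u * B ^ θ) ^ R = (C * B ^ n) ^ ε := by
    intro B hB
    rw [mul_pow, hu, ← Real.rpow_mul_natCast (by positivity), ← Real.rpow_mul_natCast hB.le, hθ,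
      one_div, inv_mul_cancel₀ hRpos.ne', Real.rpow_one, div_mul_cancel₀ _ hRpos.ne',
      Real.rpow_mul hB.le, Real.rpow_natCast, ← Real.mul_rpow (by positivity) (by positivity)]
  have hs : Fintype.card (rootPrimes f S) = (rootPrimes f S).card := Fintype.card_coe _
  set m := (rootPrimes f S).card - 1 with hm
  -- Ensures `Q ^ H ≤ B ^ (θ / 2)`, leaving room below `U` for the exponent at `i₀`.
  set η := θ / (2 * Real.log Q) with hη
  have hηpos : 0 < η := by positivity
  set a := (η / 2) ^ m / (u * P * Q) with ha
  have hapos : 0 < a := by positivity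
  refine ⟨a / 2, by positivity, ?_⟩
  filter_upwards [eventually_ge_atTop 3, Real.tendsto_log_atTop.eventually_ge_atTop (2 / η),
    eventually_const_mul_rpow_le (half_lt_self hθ0) 1 hupos,
    eventually_const_mul_rpow_le hθ1 (2 * (u * P * Q)) one_pos,
    eventually_const_mul_rpow_le (sub_pos.2 hθ1) (n : ℝ) (half_pos hapos)]
    with B hB3 hBη hBu hBUPQ hBn
  rw [Real.rpow_one, one_mul] at hBUPQ
  rw [one_mul] at hBu
  rw [Real.rpow_zero, mul_one] at hBn
  have hB0 : 0 < B := by linarith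
  have hlog : 1 ≤ Real.log B := by
    rw [Real.le_log_iff_exp_le hB0]
    linarith [Real.exp_one_lt_d9]
  set H := ⌊η * Real.log B⌋₊ with hH
  have hH1 : η / 2 * Real.log B ≤ H := by
    have h1 := Nat.lt_floor_add_one (η * Real.log B)
    rw [div_le_iff₀ hηpos] at hBη
    linarith
  have hH2 : (Q : ℝ) ^ H ≤ u * B ^ θ := by
    refine le_trans ?_ hBu
    rw [← Real.rpow_natCast, Real.rpow_def_of_pos hQ0, Real.rpow_def_of_pos hB0]
    apply Real.exp_le_exp.2
    have h1 : (H : ℝ) ≤ η * Real.log B := Nat.floor_le (by positivity)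
    calc Real.log Q * H ≤ Real.log Q * (η * Real.log B) := by gcongr
      _ = Real.log B * (θ / 2) := by rw [hη]; field_simp
  obtain ⟨s, hs1, hs2⟩ := exists_finset_close (p := fun i : rootPrimes f S => (i : ℕ))
    Subtype.val_injective hP y (B := B) hH2 (by linarith)
  obtain ⟨s', hs1', hs2'⟩ := countN_eq_card f S hε₀ B
  -- Integer roots of `f` are not counted; there are at most `n`, absorbed by halving `a`.
  have hsub : s ⊆ s' ∪ f.roots.toFinset := by
    intro x hx
    obtain ⟨hxB, k, hk, hUk⟩ := hs1 x hx
    rw [Finset.mem_union, hs2', Multiset.mem_toFinset, mem_roots hf]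
    by_cases hfx : f.eval x = 0
    · exact Or.inr hfx
    refine Or.inl ⟨hxB, hfx, le_trans ?_ (prod_pow_le_sPart_eval hS hy hfx hk)⟩
    calc |((f.eval x : ℤ) : ℝ)| ^ ε ≤ (C * B ^ n) ^ ε :=
          Real.rpow_le_rpow (abs_nonneg _) (hCf B (by linarith) x hxB) hε₀.le
      _ = (u * B ^ θ) ^ R := (hUpow B hB0).symm
      _ ≤ _ := by gcongr
  have hcard : (s.card : ℝ) ≤ countN f S ε B + n := by
    rw [← hs1']
    have h1 := (Finset.card_le_card hsub).trans (Finset.card_union_le _ _)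
    have h2 := (Multiset.toFinset_card_le f.roots).trans f.card_roots'
    exact_mod_cast h1.trans (Nat.add_le_add_left h2 _)
  rw [hs] at hs2
  have hmain : a * (B ^ (1 - θ) * Real.log B ^ m) ≤ s.card := by
    refine le_trans ?_ hs2
    have h1 : a * (B ^ (1 - θ) * Real.log B ^ m) =
        (η / 2 * Real.log B) ^ m * (B / (u * B ^ θ * P * Q)) := by
      rw [ha, Real.rpow_sub hB0, Real.rpow_one, mul_pow]
      field_simp
    rw [h1]
    gcongr
  have hlogm : B ^ (1 - θ) ≤ B ^ (1 - θ) * Real.log B ^ m :=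
    le_mul_of_one_le_right (by positivity) (one_le_pow₀ hlog)
  have := mul_le_mul_of_nonneg_left hlogm (half_pos hapos).le
  linarith

end Bounds

end SParts

theorem mainTheorem3
    (f : ℤ[X]) (hf : 1 ≤ f.natDegree)
    (K : Type*) [Field K] [Algebra ℚ K]
    [(f.map (Int.castRingHom ℚ)).IsSplittingField ℚ K]
    (S : Finset ℕ) (hS : ∀ p ∈ S, p.Prime)
    (hs' : 1 ≤ (SParts.rootPrimes f S).card)
    (hsplit : ∀ p ∈ SParts.rootPrimes f S, SParts.SplitsCompletely p K)
    (hlead : ∀ p ∈ SParts.rootPrimes f S, ¬ (p : ℤ) ∣ f.leadingCoeff)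
    (ε : ℝ) (hε₀ : 0 < ε)
    (hε₁ : ε < (SParts.maxRootMultiplicity f K : ℝ) / (f.natDegree : ℝ)) :
    (fun B : ℝ => (SParts.countN f S ε B : ℝ)) =Θ[atTop]
      (fun B : ℝ =>
        B ^ (1 - (f.natDegree : ℝ) * ε / (SParts.maxRootMultiplicity f K : ℝ)) *
          (Real.log B) ^ ((SParts.rootPrimes f S).card - 1)) := by
  classical
  have hf0 : f ≠ 0 := by
    rintro rfl
    simp at hf
  have : CharZero K := algebraRat.charZero K
  have : FiniteDimensional ℚ K :=
    IsSplittingField.finiteDimensional K (f.map (Int.castRingHom ℚ))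
  have : NumberField K := {
    to_charZero := inferInstance
    -- The given `ℚ`-algebra structure agrees with the canonical one by uniqueness.
    to_finiteDimensional := by convert this; exact Subsingleton.elim _ _ }
  have : ∀ i : SParts.rootPrimes f S, Fact (i : ℕ).Prime := fun i =>
    ⟨hS i (Finset.filter_subset _ _ i.2)⟩
  have hσ : ∀ i : SParts.rootPrimes f S, Nonempty (K →+* ℚ_[i]) := fun i =>
    SParts.exists_ringHom_padic_of_splitsCompletely (hsplit i i.2)
  have hR0 := SParts.one_le_maxRootMultiplicity (K := K) hf
  set R := SParts.maxRootMultiplicity f K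
  have hRpos : (0 : ℝ) < R := by exact_mod_cast hR0
  have hn : (0 : ℝ) < f.natDegree := by exact_mod_cast hf
  have hθ0 : 0 < (f.natDegree : ℝ) * ε / R := by positivity
  have hθ1 : (f.natDegree : ℝ) * ε / R < 1 := by
    rw [lt_div_iff₀ hn] at hε₁
    rw [div_lt_one hRpos]
    linarith
  obtain ⟨A, hA⟩ := SParts.exists_eventually_countN_le hS hf0 hs' hR0
    (fun i y => SParts.rootMultiplicity_padicInt_le (hσ i).some hf0 y) hε₀ rfl hθ0 hθ1
  obtain ⟨A', hA'0, hA'⟩ := SParts.exists_eventually_le_countN hS hf0 hs' hR0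
    (fun i => SParts.exists_padicInt_rootMultiplicity_eq (hσ i).some hf (hlead i i.2))
    hε₀ rfl hθ0 hθ1
  refine ⟨IsBigO.of_bound A ?_, IsBigO.of_bound A'⁻¹ ?_⟩
  · filter_upwards [hA, eventually_ge_atTop 1] with B hB hB1
    have := Real.log_nonneg hB1
    rwa [Real.norm_of_nonneg (by positivity), Real.norm_of_nonneg (by positivity)]
  · filter_upwards [hA', eventually_ge_atTop 1] with B hB hB1
    have := Real.log_nonneg hB1
    rw [Real.norm_of_nonneg (by positivity), Real.norm_of_nonneg (by positivity),
      inv_mul_eq_div, le_div_iff₀ hA'0]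
    linarith
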